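/- Let $k \ge 1$ be an integer and let $f = \sum c_{ij} X^i Y^j \in \mathbb{R}[X,Y]$ be a real polynomial whose Newton polygon, i.e. the convex hull in $\mathbb{R}^2$ of the set $\{(i,j) : c_{ij} \neq 0\}$, is the quadrangle with vertices $(0,1)$, $(0,2)$, $(1,0)$ and $(2k-1,1)$. Then the real algebraic curve $f = 0$ has no $A_{2k-1}^{\bullet}$ point: there is no point $p \in \mathbb{R}^2$ near which the curve is given by the equation $x^{2k} + y^2 = 0$ in suitable real analytic local coordinates $(x,y)$ centred at $p$, that is, such that $f = u \cdot (x^{2k} + y^2)$ in a neighbourhood of $p$ with $u$ a nowhere vanishing real analytic function. -/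

import Mathlib

/-- The Newton polygon of a real polynomial in two variables: the convex hull in `ℝ²` of the
exponent vectors `(i, j)` of the monomials `X ^ i * Y ^ j` that occur in `f` with a nonzero
coefficient (the variable `0` is `X`, the variable `1` is `Y`). -/
def newtonPolygon (f : MvPolynomial (Fin 2) ℝ) : Set (Fin 2 → ℝ) :=
  convexHull ℝ ((fun (m : Fin 2 →₀ ℕ) (i : Fin 2) => (m i : ℝ)) '' (f.support : Set (Fin 2 →₀ ℕ)))

/-- The quadrangle with vertices `(0, 1)`, `(0, 2)`, `(1, 0)` and `(2k - 1, 1)`. -/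
def quadrangle (k : ℕ) : Set (Fin 2 → ℝ) :=
  convexHull ℝ {![0, 1], ![0, 2], ![1, 0], ![2 * (k : ℝ) - 1, 1]}

/-- The real point `p` is an `A_{2k-1}`-solitary point of the real plane curve `f = 0`: near `p`
there are real analytic coordinates `φ = (x, y)` centred at `p` in which the curve is given by the
equation `x ^ (2k) + y ^ 2 = 0`, that is, `f` is `x ^ (2k) + y ^ 2` times a nowhere vanishing
real analytic function `u`. -/
def IsSolitaryAPoint (k : ℕ) (f : MvPolynomial (Fin 2) ℝ) (p : Fin 2 → ℝ) : Prop :=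
  ∃ (φ : OpenPartialHomeomorph (Fin 2 → ℝ) (Fin 2 → ℝ)) (u : (Fin 2 → ℝ) → ℝ),
    p ∈ φ.source ∧ φ p = 0 ∧
    AnalyticOnNhd ℝ φ φ.source ∧ AnalyticOnNhd ℝ φ.symm φ.target ∧
    AnalyticOnNhd ℝ u φ.source ∧ (∀ q ∈ φ.source, u q ≠ 0) ∧
    ∀ q ∈ φ.source, MvPolynomial.eval q f = u q * ((φ q 0) ^ (2 * k) + (φ q 1) ^ 2)

/-! The polygon forces `f = b Y² + P(X) Y + c X` with `deg P < 2k` and `P(0) ≠ 0`. With `s = 4bc`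
and `D = P² - s X`, completing the square gives `4bf = (2bY + P)² - D`. A solitary point over `x₀`
makes `D` negative on both sides of `x₀` (`discriminant_neg`) and zero to order `2k` at `x₀`
(`pow_dvd_discriminant`).

These are incompatible (`discriminant_nonneg_frequently`). Since `X D' - D = P (2 X P' - P)`, the
order of vanishing and the degree bound leave `2 X P' - P = c' (X - x₀)^(2k-1)` with `c'` constant.
Differentiating, `Q(w) = P(w²/s)` has `Q''` a constant times an even power; the sign of `P(0)`,
positive up to `P ↦ -P`, makes `Q` convex. It touches the diagonal at `w₀ = P(x₀) > 0`, so `Q(w) ≥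
w`, and `D(w²/s) = Q(w)² - w² ≥ 0` for `w > w₀`. -/

/-! ### Convexity and the sign of the discriminant -/

open Polynomial in
/-- If the discriminant `P ^ 2 - s X` of `b Y ^ 2 + P Y + c X` vanishes to order `2k` at `x₀` and
`deg P < 2k`, it takes nonnegative values arbitrarily close to `x₀`: the function `w ↦ P (w ^ 2 / s)`
is convex and tangent to the diagonal. -/
theorem discriminant_nonneg_frequently (k : ℕ) (hk : 1 ≤ k) (P : ℝ[X])
    (hdeg : P.natDegree ≤ 2 * k - 1)
    (hP0 : 0 < P.eval 0) (s : ℝ) (hs : s ≠ 0) (x₀ : ℝ)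
    (hdvd : (X - C x₀) ^ (2 * k) ∣ P ^ 2 - C s * X) :
    ∃ᶠ x in nhdsWithin x₀ {x₀}ᶜ, 0 ≤ (P ^ 2 - C s * X).eval x := by
  obtain ⟨n, hn⟩ : ∃ n, 2 * k = n + 1 := ⟨2 * k - 1, by omega⟩
  have hn1 : Even (n - 1) ∧ 1 ≤ n := ⟨⟨k - 1, by omega⟩, by omega⟩
  rw [hn] at hdvd
  have hdegn : P.natDegree ≤ n := by omega
  have hroot : P.eval x₀ ^ 2 = s * x₀ := by
    have h : (X - C x₀) ∣ P ^ 2 - C s * X := (dvd_pow_self _ (by omega)).trans hdvd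
    have h2 := dvd_iff_isRoot.1 h
    simp only [IsRoot.def, eval_sub, eval_pow, eval_mul, eval_C, eval_X] at h2
    linarith
  have hx₀ : x₀ ≠ 0 := by
    rintro rfl
    nlinarith
  have hsx : s * x₀ ≠ 0 := mul_ne_zero hs hx₀
  have hPx : P.eval x₀ ≠ 0 := fun h => hsx (by rw [← hroot, h]; norm_num)
  have hsxpos : 0 < s * x₀ := by rw [← hroot]; positivity
  have hd : (X - C x₀) ^ n ∣ derivative (P ^ 2 - C s * X) := by
    simpa using pow_sub_one_dvd_derivative_of_pow_dvd hdvd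
  have hW : (X - C x₀) ^ n ∣ P * (2 * X * derivative P - P) := by
    have h1 : P * (2 * X * derivative P - P)
        = X * derivative (P ^ 2 - C s * X) - (P ^ 2 - C s * X) := by
      simp only [derivative_sub, derivative_pow, derivative_mul, derivative_C, derivative_X]
      norm_num [C_ofNat]
      ring
    rw [h1]
    exact dvd_sub (hd.mul_left _) ((pow_dvd_pow _ (Nat.le_succ n)).trans hdvd)
  have hcop : IsCoprime ((X - C x₀) ^ n) P := by
    refine IsCoprime.pow_left ((irreducible_X_sub_C x₀).coprime_iff_not_dvd.2 ?_)
    rwa [dvd_iff_isRoot]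
  obtain ⟨G, hG⟩ := hcop.dvd_of_dvd_mul_left hW
  have hGC : ∃ c, G = C c := by
    refine ⟨G.coeff 0, eq_C_of_natDegree_eq_zero ?_⟩
    by_contra hne
    have hG0 : G ≠ 0 := by rintro rfl; simp at hne
    have h1 : (2 * X * derivative P - P).natDegree ≤ n := by
      refine (natDegree_sub_le _ _).trans (max_le ?_ hdegn)
      by_cases hz : P.natDegree = 0
      · rw [eq_C_of_natDegree_eq_zero hz]; simp
      have h2 := natDegree_derivative_lt hz
      have h3 : (2 * X * derivative P : ℝ[X]).natDegree ≤ 1 + (derivative P).natDegree := by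
        refine natDegree_mul_le.trans (Nat.add_le_add_right ?_ _)
        exact (natDegree_C_mul_le (2 : ℝ) X).trans natDegree_X_le
      omega
    rw [hG, natDegree_mul (pow_ne_zero _ (X_sub_C_ne_zero _)) hG0, natDegree_pow,
      natDegree_X_sub_C] at h1
    omega
  obtain ⟨c, rfl⟩ := hGC
  have hc : P.eval 0 = c * x₀ ^ n := by
    have h := congrArg (eval 0) hG
    have hodd : Odd n := ⟨k - 1, by omega⟩
    simp [hodd.neg_pow] at h
    linarith
  -- The sign comes from `s x₀ = P(x₀)² > 0` and `n - 1` being even.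
  have hcs : 0 < c / s := by
    have h1 : P.eval 0 = (c / s) * ((s * x₀) * x₀ ^ (n - 1)) := by
      rw [hc]
      obtain ⟨m, rfl⟩ : ∃ m, n = m + 1 := ⟨n - 1, by omega⟩
      simp only [Nat.add_sub_cancel]
      rw [pow_succ]
      field_simp
    rw [h1] at hP0
    exact pos_of_mul_pos_left hP0 (mul_nonneg hsxpos.le (hn1.1.pow_nonneg _))
  have hODE : derivative P + 2 * X * derivative (derivative P)
      = C (c * n) * (X - C x₀) ^ (n - 1) := by
    have h := congrArg derivative hG
    simp only [derivative_sub, derivative_mul, derivative_X, derivative_C, derivative_pow,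
      derivative_ofNat] at h
    simp only [C_mul, map_natCast] at h ⊢
    linear_combination h
  set Q : ℝ[X] := P.comp (C (1 / s) * X ^ 2) with hQ
  have hQe : ∀ w, Q.eval w = P.eval (w ^ 2 / s) := fun w => by
    simp [hQ, eval_comp, div_eq_inv_mul]
  have hQ1 : ∀ w, (derivative Q).eval w = 2 * w / s * (derivative P).eval (w ^ 2 / s) := fun w => by
    simp [hQ, derivative_comp, eval_comp]; ring_nf
  have hQ2 : ∀ w, (derivative (derivative Q)).eval w
      = 2 * n * (c / s) * (w ^ 2 / s - x₀) ^ (n - 1) := fun w => by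
    have h := congrArg (eval (w ^ 2 / s)) hODE
    have h2 : (derivative (derivative Q)).eval w = 2 / s * (derivative P +
        2 * X * derivative (derivative P)).eval (w ^ 2 / s) := by
      simp [hQ, derivative_comp, eval_comp, derivative_mul]
      ring_nf
    rw [h2, h]
    simp only [eval_mul, eval_C, eval_pow, eval_sub, eval_X]
    ring
  have hconv : ConvexOn ℝ Set.univ (fun w => Q.eval w) := by
    refine convexOn_univ_of_deriv2_nonneg Q.differentiable ?_ ?_
    · have : deriv (fun w => Q.eval w) = fun w => (derivative Q).eval w := by
        ext w; exact Q.deriv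
      rw [this]; exact (derivative Q).differentiable
    · intro w
      have : deriv (fun w => Q.eval w) = fun w => (derivative Q).eval w := by
        ext w; exact Q.deriv
      rw [Function.iterate_succ, Function.iterate_one, Function.comp_apply, this,
        Polynomial.deriv, hQ2]
      exact mul_nonneg (by positivity) (hn1.1.pow_nonneg _)
  set w₀ := P.eval x₀ with hw₀
  have hxw : w₀ ^ 2 / s = x₀ := by rw [hroot]; field_simp
  have hQw : Q.eval w₀ = w₀ := by rw [hQe, hxw]
  -- `Q` is even, so midpoint convexity at `±w₀` gives `P(0) = Q(0) ≤ w₀`.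
  have hw₀pos : 0 < w₀ := by
    have h := hconv.2 (Set.mem_univ w₀) (Set.mem_univ (-w₀)) (show (0 : ℝ) ≤ 1 / 2 by norm_num)
      (show (0 : ℝ) ≤ 1 / 2 by norm_num) (by norm_num)
    have h0 : Q.eval 0 = P.eval 0 := by rw [hQe]; simp
    have h1 : Q.eval (-w₀) = w₀ := by rw [hQe, neg_sq, hxw]
    simp only [smul_eq_mul, mul_neg, add_neg_cancel, h0, h1, hQw] at h
    linarith
  have hQ'w : (derivative Q).eval w₀ = 1 := by
    have h : (X - C x₀) ∣ derivative (P ^ 2 - C s * X) := (dvd_pow_self _ (by omega)).trans hd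
    have h2 := dvd_iff_isRoot.1 h
    simp [derivative_pow, ← hw₀] at h2
    rw [hQ1, hxw]
    field_simp
    linarith
  have htangent : ∀ w, w ≤ Q.eval w := by
    intro w
    have hder : HasDerivAt (fun w => Q.eval w) 1 w₀ := hQ'w ▸ Q.hasDerivAt w₀
    rcases lt_trichotomy w w₀ with h | h | h
    · have := hconv.slope_le_of_hasDerivAt (Set.mem_univ w) (Set.mem_univ w₀) h hder
      rw [slope_def_field, div_le_one (by linarith), hQw] at this
      linarith
    · rw [h, hQw]
    · have := hconv.le_slope_of_hasDerivAt (Set.mem_univ w₀) (Set.mem_univ w) h hder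
      rw [slope_def_field, le_div_iff₀ (by linarith), hQw] at this
      linarith
  have htend : Filter.Tendsto (fun w : ℝ => w ^ 2 / s) (nhdsWithin w₀ (Set.Ioi w₀))
      (nhdsWithin x₀ {x₀}ᶜ) := by
    refine tendsto_nhdsWithin_iff.2 ⟨?_, ?_⟩
    · have : Continuous fun w : ℝ => w ^ 2 / s := by fun_prop
      have h := this.tendsto w₀
      rw [hxw] at h
      exact h.mono_left nhdsWithin_le_nhds
    · filter_upwards [self_mem_nhdsWithin] with w hw
      have hw : w₀ < w := hw
      intro h
      have h : w ^ 2 / s = x₀ := h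
      rw [← hxw, div_left_inj' hs] at h
      nlinarith
  refine htend.frequently (Filter.Eventually.frequently ?_)
  filter_upwards [self_mem_nhdsWithin] with w hw
  have hw : w₀ < w := hw
  have h := htangent w
  rw [hQe] at h
  simp only [eval_sub, eval_pow, eval_mul, eval_C, eval_X]
  rw [mul_div_cancel₀ _ hs]
  nlinarith

/-! ### Newton polygon and normal form -/

/-- One inequality per edge; the fourth, `0 ≤ v 0`, is automatic for exponents. -/
theorem mem_quadrangle_bounds {k : ℕ} (hk : 1 ≤ k) {v : Fin 2 → ℝ} (hv : v ∈ quadrangle k) :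
    1 ≤ v 0 + v 1 ∧ v 0 ≤ 1 + (2 * k - 2) * v 1 ∧ v 0 ≤ (2 * k - 1) * (2 - v 1) := by
  have hk' : (1 : ℝ) ≤ k := by exact_mod_cast hk
  have hconv : Convex ℝ {v : Fin 2 → ℝ |
      1 ≤ v 0 + v 1 ∧ v 0 ≤ 1 + (2 * k - 2) * v 1 ∧ v 0 ≤ (2 * k - 1) * (2 - v 1)} := by
    intro x hx y hy a b ha hb hab
    obtain ⟨hx1, hx2, hx3⟩ := hx
    obtain ⟨hy1, hy2, hy3⟩ := hy
    simp only [Set.mem_ofPred_eq, Pi.add_apply, Pi.smul_apply, smul_eq_mul]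
    obtain rfl : b = 1 - a := by linarith
    refine ⟨?_, ?_, ?_⟩
    · linear_combination a * hx1 + (1 - a) * hy1
    · linear_combination a * hx2 + (1 - a) * hy2
    · linear_combination a * hx3 + (1 - a) * hy3
  refine convexHull_min ?_ hconv hv
  rintro w (rfl | rfl | rfl | rfl) <;>
    refine ⟨?_, ?_, ?_⟩ <;> norm_num <;> linarith

/-- Otherwise the support, hence its hull, would lie in a half-plane missing `m`. This turns
vertices into nonzero coefficients. -/
theorem mem_support_of_exposed {f : MvPolynomial (Fin 2) ℝ} {S : Set (Fin 2 → ℝ)}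
    (hf : newtonPolygon f = S) (m : Fin 2 →₀ ℕ) (hm : (fun i => (m i : ℝ)) ∈ S) (α β r : ℝ)
    (hlt : α * m 0 + β * m 1 < r)
    (hle : ∀ d ∈ f.support, d ≠ m → r ≤ α * d 0 + β * d 1) : m ∈ f.support := by
  by_contra hmem
  have hconv : Convex ℝ {v : Fin 2 → ℝ | r ≤ α * v 0 + β * v 1} := by
    intro x hx y hy a b ha hb hab
    simp only [Set.mem_ofPred_eq, Pi.add_apply, Pi.smul_apply, smul_eq_mul] at hx hy ⊢
    obtain rfl : b = 1 - a := by linarith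
    linear_combination a * hx + (1 - a) * hy
  rw [← hf] at hm
  have := convexHull_min (𝕜 := ℝ) (t := {v : Fin 2 → ℝ | r ≤ α * v 0 + β * v 1}) ?_ hconv hm
  · exact absurd hlt (not_lt.2 this)
  · rintro _ ⟨d, hd, rfl⟩
    exact hle d hd fun h => hmem (h ▸ hd)

open Polynomial in
/-- The normal form of a polynomial whose Newton polygon is `quadrangle k`. -/
theorem exists_eval_eq_of_newtonPolygon (k : ℕ) (hk : 1 ≤ k) (f : MvPolynomial (Fin 2) ℝ)
    (hf : newtonPolygon f = quadrangle k) :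
    ∃ (b c : ℝ) (P : ℝ[X]), b ≠ 0 ∧ c ≠ 0 ∧ P.eval 0 ≠ 0 ∧ P.natDegree ≤ 2 * k - 1 ∧
      ∀ q : Fin 2 → ℝ, MvPolynomial.eval q f = b * q 1 ^ 2 + P.eval (q 0) * q 1 + c * q 0 := by
  set e : ℕ → ℕ → (Fin 2 →₀ ℕ) := fun i j => Finsupp.single 0 i + Finsupp.single 1 j with he
  have e0 : ∀ i j, e i j 0 = i := fun i j => by simp [he]
  have e1 : ∀ i j, e i j 1 = j := fun i j => by simp [he]
  have heq : ∀ d : Fin 2 →₀ ℕ, d = e (d 0) (d 1) := fun d => by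
    ext i; fin_cases i <;> simp [he]
  have hmon : ∀ d ∈ f.support, d = e 0 2 ∨ d = e 1 0 ∨ ∃ i < 2 * k, d = e i 1 := by
    intro d hd
    have hq : (fun i => (d i : ℝ)) ∈ quadrangle k := by
      rw [← hf]; exact subset_convexHull ℝ _ ⟨d, hd, rfl⟩
    obtain ⟨h1, h2, h3⟩ := mem_quadrangle_bounds hk hq
    have hk' : (1 : ℝ) ≤ k := by exact_mod_cast hk
    have hd0 : (0 : ℝ) ≤ d 0 := Nat.cast_nonneg _
    have hd1 : d 1 ≤ 2 := by
      by_contra h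
      have : (3 : ℝ) ≤ d 1 := by exact_mod_cast (by omega : 3 ≤ d 1)
      nlinarith
    rw [heq d]
    generalize d 0 = i at *
    generalize d 1 = j at *
    interval_cases j
    · right; left
      norm_num at h1 h2
      rw [le_antisymm h2 h1]
    · right; right
      refine ⟨i, ?_, rfl⟩
      have : (i : ℝ) < (2 * k : ℕ) := by push_cast at *; linarith
      exact_mod_cast this
    · left
      norm_num at h3
      rw [h3]
  have hv : ∀ v ∈ ({![0, 1], ![0, 2], ![1, 0], ![2 * (k : ℝ) - 1, 1]} : Set (Fin 2 → ℝ)),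
      v ∈ quadrangle k := fun v hv => subset_convexHull ℝ _ hv
  have hcast : ∀ i j : ℕ, (fun l => ((e i j l : ℕ) : ℝ)) = ![(i : ℝ), (j : ℝ)] := fun i j => by
    ext l; fin_cases l <;> simp [e0, e1]
  have h02 : e 0 2 ∈ f.support := by
    refine mem_support_of_exposed hf _ (hv _ (by rw [hcast]; simp)) 0 (-1) (-1)
      (by norm_num [e1]) fun d hd hne => ?_
    rcases hmon d hd with rfl | rfl | ⟨i, -, rfl⟩
    · exact absurd rfl hne
    · norm_num [e1]
    · norm_num [e1]
  have h10 : e 1 0 ∈ f.support := by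
    refine mem_support_of_exposed hf _ (hv _ (by rw [hcast]; simp)) 0 1 1
      (by norm_num [e1]) fun d hd hne => ?_
    rcases hmon d hd with rfl | rfl | ⟨i, -, rfl⟩
    · norm_num [e1]
    · exact absurd rfl hne
    · norm_num [e1]
  -- The functional `2i + j` is `1` at `(0, 1)` and at least `2` at every other possible exponent.
  have h01 : e 0 1 ∈ f.support := by
    refine mem_support_of_exposed hf _ (hv _ (by rw [hcast]; simp)) 2 1 2
      (by norm_num [e0, e1]) fun d hd hne => ?_
    rcases hmon d hd with rfl | rfl | ⟨i, -, rfl⟩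
    · norm_num [e0, e1]
    · norm_num [e0, e1]
    · have hi : 1 ≤ i := Nat.one_le_iff_ne_zero.2 fun h => hne (by rw [h])
      have hi : (1 : ℝ) ≤ i := by exact_mod_cast hi
      rw [e0, e1]; push_cast; linarith
  refine ⟨f.coeff (e 0 2), f.coeff (e 1 0),
    ∑ i ∈ Finset.range (2 * k), C (f.coeff (e i 1)) * X ^ i,
    MvPolynomial.mem_support_iff.1 h02, MvPolynomial.mem_support_iff.1 h10, ?_, ?_, fun q => ?_⟩
  · rw [eval_finsetSum, Finset.sum_eq_single_of_mem 0 (Finset.mem_range.2 (by omega))]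
    · simpa using MvPolynomial.mem_support_iff.1 h01
    · intro i _ hi; simp [hi]
  · refine natDegree_sum_le_of_forall_le _ _ fun i hi => ?_
    have := Finset.mem_range.1 hi
    exact (natDegree_C_mul_X_pow_le _ _).trans (by omega)
  · have hinj : Function.Injective fun i => e i 1 := fun i j h => by
      simpa [e0] using DFunLike.congr_fun h 0
    have hne : ∀ {i j i' j' : ℕ}, j ≠ j' → e i j ≠ e i' j' := fun h h' => h <| by
      simpa [e1] using DFunLike.congr_fun h' 1
    rw [MvPolynomial.eval_eq', Finset.sum_subset
      (s₂ := insert (e 0 2) (insert (e 1 0) ((Finset.range (2 * k)).image fun i => e i 1)))]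
    · rw [Finset.sum_insert, Finset.sum_insert, Finset.sum_image hinj.injOn]
      · simp only [Fin.prod_univ_two, e0, e1, eval_finsetSum, eval_mul, eval_C, eval_pow, eval_X,
          Finset.sum_mul]
        simp [mul_assoc]
        ring
      · simp only [Finset.mem_image, not_exists, not_and]
        exact fun i _ => hne (by norm_num)
      · simp only [Finset.mem_insert, Finset.mem_image, not_or, not_exists, not_and]
        exact ⟨hne (by norm_num), fun i _ => hne (by norm_num)⟩
    · intro d hd
      simp only [Finset.mem_insert, Finset.mem_image, Finset.mem_range]
      rcases hmon d hd with h | h | ⟨i, hi, h⟩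
      · exact Or.inl h
      · exact Or.inr (Or.inl h)
      · exact Or.inr (Or.inr ⟨i, hi, h.symm⟩)
    · intro d _ hd
      rw [MvPolynomial.notMem_support_iff.1 hd, zero_mul]

/-! ### Local analysis at a solitary point -/

open Polynomial Filter Topology in
/-- Near a solitary point the discriminant is negative, and it vanishes at the point. -/
theorem IsSolitaryAPoint.discriminant_neg {k : ℕ} (hk : 1 ≤ k) {f : MvPolynomial (Fin 2) ℝ}
    {b c : ℝ} {P : ℝ[X]} (hb : b ≠ 0)
    (hf : ∀ q : Fin 2 → ℝ, MvPolynomial.eval q f = b * q 1 ^ 2 + P.eval (q 0) * q 1 + c * q 0)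
    {p : Fin 2 → ℝ} (h : IsSolitaryAPoint k f p) :
    (∀ᶠ x in 𝓝[≠] (p 0), (P ^ 2 - C (4 * b * c) * X).eval x < 0) ∧
      (P ^ 2 - C (4 * b * c) * X).eval (p 0) = 0 ∧ 2 * b * p 1 + P.eval (p 0) = 0 := by
  obtain ⟨φ, u, hp, hφp, -, -, -, hu, hfu⟩ := h
  set D : ℝ[X] := P ^ 2 - C (4 * b * c) * X with hD
  have hDe : ∀ x, D.eval x = P.eval x ^ 2 - 4 * b * c * x := fun x => by simp [hD]
  have hp0 : MvPolynomial.eval p f = 0 := by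
    rw [hfu p hp, hφp]
    have : 2 * k ≠ 0 := by omega
    simp [this]
  have hisol : ∀ q ∈ φ.source, MvPolynomial.eval q f = 0 → q = p := by
    intro q hq h0
    rw [hfu q hq] at h0
    have h1 := (mul_eq_zero.1 h0).resolve_left (hu q hq)
    have e1 : 0 ≤ (φ q 0) ^ (2 * k) := (even_two_mul k).pow_nonneg _
    have e2 := sq_nonneg (φ q 1)
    have z1 : φ q 0 = 0 := pow_eq_zero_iff (by omega) |>.1 (by linarith : (φ q 0) ^ (2 * k) = 0)
    have z2 : φ q 1 = 0 := pow_eq_zero_iff (by omega) |>.1 (by linarith : (φ q 1) ^ 2 = 0)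
    refine φ.injOn hq hp ?_
    rw [hφp]
    ext i; fin_cases i <;> simp [z1, z2]
  have hDp : D.eval (p 0) = (2 * b * p 1 + P.eval (p 0)) ^ 2 := by
    rw [hf] at hp0
    rw [hDe]
    linear_combination -4 * b * hp0
  -- `σ` selects the branch of the quadratic formula through `p`. Since `√` is `0` on negatives, the
  -- branch `r` is continuous everywhere; where `D ≥ 0` it lies on the curve, in which `p` is
  -- isolated.
  obtain ⟨σ, hσ, hσz⟩ : ∃ σ : ℝ, σ ^ 2 = 1 ∧
      σ * √(D.eval (p 0)) = 2 * b * p 1 + P.eval (p 0) := by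
    rw [hDp, Real.sqrt_sq_eq_abs]
    rcases abs_choice (2 * b * p 1 + P.eval (p 0)) with h | h
    · exact ⟨1, by norm_num, by rw [h, one_mul]⟩
    · exact ⟨-1, by norm_num, by rw [h]; ring⟩
  set r : ℝ → Fin 2 → ℝ := fun x => ![x, (σ * √(D.eval x) - P.eval x) / (2 * b)] with hr
  have hrc : Continuous r := by
    refine continuous_pi fun i => ?_
    fin_cases i
    · exact continuous_id
    · have := D.continuous
      have := P.continuous
      simp only [hr]
      change Continuous fun x => (σ * √(D.eval x) - P.eval x) / (2 * b)
      fun_prop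
  have hrp : r (p 0) = p := by
    ext i; fin_cases i
    · rfl
    · change (σ * √(D.eval (p 0)) - P.eval (p 0)) / (2 * b) = p 1
      rw [hσz]; field_simp; ring
  have hneg : ∀ᶠ x in 𝓝[≠] (p 0), D.eval x < 0 := by
    have hsrc : ∀ᶠ x in 𝓝 (p 0), r x ∈ φ.source :=
      hrc.continuousAt.eventually (by rw [hrp]; exact φ.open_source.mem_nhds hp)
    filter_upwards [hsrc.filter_mono nhdsWithin_le_nhds, self_mem_nhdsWithin] with x hx hne
    by_contra! hnn
    refine hne (congrFun (hisol _ hx ?_) 0)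
    rw [hf]
    change b * ((σ * √(D.eval x) - P.eval x) / (2 * b)) ^ 2 +
      P.eval x * ((σ * √(D.eval x) - P.eval x) / (2 * b)) + c * x = 0
    have hs := Real.sq_sqrt hnn
    generalize √(D.eval x) = R at hs
    rw [hDe] at hs
    field_simp
    linear_combination R ^ 2 * hσ + hs
  have hle : D.eval (p 0) ≤ 0 :=
    le_of_tendsto (D.continuous.continuousAt.mono_left nhdsWithin_le_nhds)
      (hneg.mono fun x hx => hx.le)
  have hz : D.eval (p 0) = 0 := le_antisymm hle (hDp ▸ sq_nonneg _)
  exact ⟨hneg, hz, pow_eq_zero_iff (by norm_num) |>.1 (hDp ▸ hz)⟩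

open Polynomial Filter Topology Asymptotics in
/-- At an `A_{2k-1}` solitary point the discriminant vanishes to order `2k`. -/
theorem IsSolitaryAPoint.pow_dvd_discriminant {k : ℕ} (hk : 1 ≤ k) {f : MvPolynomial (Fin 2) ℝ}
    {b c : ℝ} {P : ℝ[X]} (hb : b ≠ 0)
    (hf : ∀ q : Fin 2 → ℝ, MvPolynomial.eval q f = b * q 1 ^ 2 + P.eval (q 0) * q 1 + c * q 0)
    {p : Fin 2 → ℝ} (h : IsSolitaryAPoint k f p) :
    (X - C (p 0)) ^ (2 * k) ∣ P ^ 2 - C (4 * b * c) * X := by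
  obtain ⟨hneg, hDp, hzp⟩ := h.discriminant_neg hk hb hf
  set D : ℝ[X] := P ^ 2 - C (4 * b * c) * X with hD
  have hDe : ∀ x, D.eval x = P.eval x ^ 2 - 4 * b * c * x := fun x => by simp [hD]
  have hD0 : D ≠ 0 := by
    intro h0
    obtain ⟨x, hx⟩ := hneg.exists
    simp [h0] at hx
  have hnonpos : ∀ᶠ x in 𝓝 (p 0), D.eval x ≤ 0 := by
    filter_upwards [eventually_nhdsWithin_iff.1 hneg] with x hx
    by_cases hxp : x = p 0
    · rw [hxp, hDp]
    · exact (hx hxp).le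
  rw [← le_rootMultiplicity_iff hD0]
  -- For `k = 1` the local maximum of `D` already gives a double root; the estimate `z = o(t)` below
  -- needs `k ≥ 2`.
  rcases hk.eq_or_lt with rfl | hk2
  · refine (one_lt_rootMultiplicity_iff_isRoot hD0).2 ⟨hDp, ?_⟩
    have hmax : IsLocalMax (fun x => D.eval x) (p 0) :=
      hnonpos.mono fun x hx => hx.trans hDp.ge
    have := hmax.deriv_eq_zero
    rwa [Polynomial.deriv] at this
  obtain ⟨φ, u, hp, hφp, hφ, -, hu, -, hfu⟩ := h
  -- Along the preimage of the first coordinate axis, `z² - D = 4bu t^(2k)`. Both `z²` and `-D` are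
  -- nonnegative, so each is `O(t^(2k))`.
  set γ : ℝ → Fin 2 → ℝ := fun t => φ.symm ![t, 0] with hγ
  have hline : Continuous fun t : ℝ => (![t, 0] : Fin 2 → ℝ) := by
    refine continuous_pi fun i => ?_
    fin_cases i
    · exact continuous_id
    · exact continuous_const
  have hline0 : (![(0 : ℝ), 0] : Fin 2 → ℝ) = 0 := by ext i; fin_cases i <;> rfl
  have h0t : (![(0 : ℝ), 0] : Fin 2 → ℝ) ∈ φ.target := by
    rw [hline0, ← hφp]; exact φ.map_source hp
  have hγ0 : γ 0 = p := by
    simp only [hγ]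
    rw [hline0, ← hφp, φ.left_inv hp]
  have hγt : Tendsto γ (𝓝 0) (𝓝 p) := by
    have h1 : ContinuousAt γ 0 := ContinuousAt.comp (f := fun t : ℝ => (![t, 0] : Fin 2 → ℝ))
      (φ.continuousAt_symm h0t) hline.continuousAt
    have h2 : Tendsto γ (𝓝 0) (𝓝 (γ 0)) := h1
    rwa [hγ0] at h2
  have htgt : ∀ᶠ t : ℝ in 𝓝 0, (![t, 0] : Fin 2 → ℝ) ∈ φ.target :=
    hline.continuousAt.eventually (φ.open_target.mem_nhds h0t)
  have hφγ : ∀ᶠ t : ℝ in 𝓝 0, φ (γ t) = ![t, 0] := htgt.mono fun t ht => φ.right_inv ht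
  have hx : Tendsto (fun t => γ t 0) (𝓝 0) (𝓝 (p 0)) := (continuous_apply 0).tendsto p |>.comp hγt
  set z : ℝ → ℝ := fun t => 2 * b * γ t 1 + P.eval (γ t 0) with hz
  have hval : ∀ᶠ t in 𝓝 0, 4 * b * u (γ t) * t ^ (2 * k) = z t ^ 2 - D.eval (γ t 0) := by
    filter_upwards [htgt, hφγ] with t ht ht'
    have h1 := hfu (γ t) (φ.map_target ht)
    rw [ht', hf] at h1
    simp only [Matrix.cons_val_zero, Matrix.cons_val_one, ne_eq, OfNat.ofNat_ne_zero,
      not_false_eq_true, zero_pow, add_zero] at h1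
    rw [hDe]
    simp only [hz]
    linear_combination -4 * b * h1
  have hO : (fun t => z t ^ 2 - D.eval (γ t 0)) =O[𝓝 0] fun t => t ^ (2 * k) := by
    have hut : Tendsto (fun t => 4 * b * u (γ t)) (𝓝 0) (𝓝 (4 * b * u p)) :=
      ((hu p hp).continuousAt.tendsto.comp hγt).const_mul _
    have := (hut.isBigO_one ℝ).mul (isBigO_refl (fun t : ℝ => t ^ (2 * k)) (𝓝 0))
    simp only [one_mul] at this
    exact this.congr' hval .rfl
  have hnp : ∀ᶠ t in 𝓝 0, D.eval (γ t 0) ≤ 0 := hx.eventually hnonpos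
  have hDO : (fun t => D.eval (γ t 0)) =O[𝓝 0] fun t => t ^ (2 * k) := by
    refine IsBigO.trans (.of_bound 1 ?_) hO
    filter_upwards [hnp] with t ht
    rw [Real.norm_of_nonpos ht, Real.norm_of_nonneg (by nlinarith [sq_nonneg (z t)])]
    nlinarith [sq_nonneg (z t)]
  have hzO : z =O[𝓝 0] fun t => t ^ k := by
    refine IsBigO.of_pow (n := 2) (by norm_num) ?_
    have h1 : (fun t : ℝ => t ^ k) ^ 2 = fun t : ℝ => t ^ (2 * k) := by
      ext t; simp [← pow_mul, mul_comm]
    rw [h1]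
    refine IsBigO.trans (.of_bound 1 ?_) hO
    filter_upwards [hnp] with t ht
    rw [Pi.pow_apply, Real.norm_of_nonneg (sq_nonneg (z t)),
      Real.norm_of_nonneg (by nlinarith [sq_nonneg (z t)])]
    linarith
  have hzo : z =o[𝓝 0] fun t : ℝ => t := by
    refine hzO.trans_isLittleO ?_
    simpa using isLittleO_pow_pow (𝕜 := ℝ) (m := 1) (n := k) hk2
  have ht1 : (fun t : ℝ => t) =O[𝓝 0] fun t => γ t - p := by
    have h1 := ((hφ p hp).differentiableAt.hasFDerivAt.isBigO_sub).comp_tendsto hγt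
    refine IsBigO.trans (.of_bound 1 ?_) h1
    filter_upwards [hφγ] with t ht
    rw [one_mul, Function.comp_apply, ht, hφp, sub_zero]
    exact norm_le_pi_norm (![t, 0] : Fin 2 → ℝ) 0
  have hP : (fun t => P.eval (γ t 0) - P.eval (p 0)) =O[𝓝 0] fun t => γ t 0 - p 0 :=
    ((P.hasDerivAt (p 0)).hasFDerivAt.isBigO_sub).comp_tendsto hx
  have hy : (fun t => γ t 1 - p 1) =O[𝓝 0] fun t => ‖z t‖ + ‖γ t 0 - p 0‖ := by
    have h1 : (fun t => γ t 1 - p 1) = fun t =>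
        (2 * b)⁻¹ * (z t - (P.eval (γ t 0) - P.eval (p 0))) := by
      ext t
      simp only [hz]
      field_simp
      linear_combination -hzp
    rw [h1]
    refine IsBigO.const_mul_left (.sub ?_ (hP.trans ?_)) _
    · refine .of_bound 1 (.of_forall fun t => ?_)
      rw [one_mul, Real.norm_of_nonneg (by positivity : 0 ≤ ‖z t‖ + ‖γ t 0 - p 0‖)]
      linarith [norm_nonneg (γ t 0 - p 0)]
    · refine .of_bound 1 (.of_forall fun t => ?_)
      rw [one_mul, Real.norm_of_nonneg (by positivity : 0 ≤ ‖z t‖ + ‖γ t 0 - p 0‖)]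
      linarith [norm_nonneg (z t)]
  have hsum : (fun t : ℝ => t) =O[𝓝 0] fun t => ‖z t‖ + ‖γ t 0 - p 0‖ := by
    refine ht1.trans (isBigO_pi.2 fun i => ?_)
    fin_cases i
    · refine .of_bound 1 (.of_forall fun t => ?_)
      rw [one_mul, Real.norm_of_nonneg (by positivity : 0 ≤ ‖z t‖ + ‖γ t 0 - p 0‖)]
      change ‖γ t 0 - p 0‖ ≤ _
      linarith [norm_nonneg (z t)]
    · exact hy
  -- As `z = o(t)`, its contribution is absorbed on the left: `γ` is not tangent to the vertical, so
  -- orders in `t` pass to orders in `x - p 0`.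
  have htx : (fun t : ℝ => t) =O[𝓝 0] fun t => γ t 0 - p 0 := by
    obtain ⟨K, hK, hKb⟩ := hsum.exists_pos
    have hsmall := hzo.def (c := (2 * K)⁻¹) (by positivity)
    refine .of_bound (2 * K) ?_
    filter_upwards [hKb.bound, hsmall] with t h1 h2
    rw [Real.norm_of_nonneg (by positivity : 0 ≤ ‖z t‖ + ‖γ t 0 - p 0‖)] at h1
    have h3 : K * ‖z t‖ ≤ ‖t‖ / 2 := by
      calc K * ‖z t‖ ≤ K * ((2 * K)⁻¹ * ‖t‖) := by gcongr
        _ = ‖t‖ / 2 := by field_simp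
    linarith
  obtain ⟨E, hE, hEnd⟩ := exists_eq_pow_rootMultiplicity_mul_and_not_dvd D hD0 (p 0)
  set m := rootMultiplicity (p 0) D with hm
  rw [dvd_iff_isRoot, IsRoot.def] at hEnd
  by_contra! hlt
  have hlow : (fun t => (γ t 0 - p 0) ^ m) =O[𝓝 0] fun t => D.eval (γ t 0) := by
    have hEt : Tendsto (fun t => (E.eval (γ t 0))⁻¹) (𝓝 0) (𝓝 (E.eval (p 0))⁻¹) :=
      (E.continuous.continuousAt.tendsto.comp hx).inv₀ hEnd
    have hEne : ∀ᶠ t in 𝓝 0, E.eval (γ t 0) ≠ 0 :=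
      (E.continuous.continuousAt.tendsto.comp hx).eventually_ne hEnd
    have := (hEt.isBigO_one ℝ).mul (isBigO_refl (fun t => D.eval (γ t 0)) (𝓝 0))
    simp only [one_mul] at this
    refine this.congr' ?_ .rfl
    filter_upwards [hEne] with t ht
    rw [hE]
    simp only [eval_mul, eval_pow, eval_sub, eval_X, eval_C]
    field_simp
  have hx0 : Tendsto (fun t => γ t 0 - p 0) (𝓝 0) (𝓝 0) := by
    simpa using hx.sub_const (p 0)
  have hself := (hlow.trans (hDO.trans (htx.pow (2 * k)))).trans_isLittleO
    ((isLittleO_pow_pow (𝕜 := ℝ) hlt).comp_tendsto hx0)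
  have hne : ∀ᶠ t in 𝓝[≠] (0 : ℝ), (γ t 0 - p 0) ^ m ≠ 0 := by
    filter_upwards [htx.eq_zero_imp.filter_mono nhdsWithin_le_nhds, self_mem_nhdsWithin]
      with t ht ht0
    exact pow_ne_zero _ fun h => ht0 (ht h)
  exact isLittleO_irrefl (hne.frequently.filter_mono nhdsWithin_le_nhds) hself

/-! ### Conclusion -/

theorem mainTheorem9 (k : ℕ) (hk : 1 ≤ k) (f : MvPolynomial (Fin 2) ℝ)
    (hf : newtonPolygon f = quadrangle k) (p : Fin 2 → ℝ) :
    ¬ IsSolitaryAPoint k f p := by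
  intro h
  obtain ⟨b, c, P, hb, hc, hP0, hdeg, hfe⟩ := exists_eval_eq_of_newtonPolygon k hk f hf
  have hneg := (h.discriminant_neg hk hb hfe).1
  have hdvd := h.pow_dvd_discriminant hk hb hfe
  have hs : 4 * b * c ≠ 0 := by positivity
  rcases hP0.lt_or_gt with hlt | hgt
  · rw [← neg_sq] at hneg hdvd
    obtain ⟨x, hx, hx'⟩ := ((discriminant_nonneg_frequently k hk (-P) (by rwa [Polynomial.natDegree_neg])
      (by rw [Polynomial.eval_neg]; linarith) _ hs _ hdvd).and_eventually hneg).exists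
    exact hx.not_gt hx'
  · obtain ⟨x, hx, hx'⟩ := ((discriminant_nonneg_frequently k hk P hdeg hgt _ hs _
      hdvd).and_eventually hneg).exists
    exact hx.not_gt hx'
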